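/- Let $R$ be a commutative Noetherian local ring with maximal ideal $\mathfrak m$, and assume that one of the following holds: (i) $R$ is Artinian; (ii) $R$ is a one-dimensional domain; (iii) $R$ is a two-dimensional normal domain whose divisor class group (Weil divisors modulo principal divisors) is torsion. For a finitely generated $R$-module $M$ and an integer $q\ge 1$, let $\Omega^q_R M$ denote the $q$-th syzygy of $M$, i.e. the image of the $q$-th differential in a minimal free resolution of $M$. For an integer $n\ge 1$, a finitely generated $R$-module $M$ is called $n$-Tor-rigid if for every finitely generated $R$-module $N$ and every integer $r\ge 1$ the following holds: if $\operatorname{Tor}_i^R(M,N)=0$ for all $i=r,r+1,\dots,r+n-1$, then $\operatorname{Tor}_j^R(M,N)=0$ for all $j\ge r$. A $1$-Tor-rigid module is called Tor-rigid. Let $M$ be a finitely generated $R$-module. If $M\cong\Omega^q_R M$ for some even integer $q\ge 2$, then $M$ is $(q-1)$-Tor-rigid. In particular, if $M\cong\Omega^2_R M$, then $M$ is Tor-rigid. -/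

import Mathlib

open CategoryTheory

universe u

/-! ### Minimal free resolutions and syzygies -/

/-- A minimal free resolution
`⋯ ⟶ R^(rank 2) ⟶ R^(rank 1) ⟶ R^(rank 0) ⟶ M ⟶ 0`
of a finitely generated module `M` over a local ring `R` with maximal ideal `𝔪`:
an exact complex of finitely generated free modules whose differentials satisfy
`im ∂ ⊆ 𝔪 F`. Here `d n` is the `(n+1)`-st differential `F_{n+1} ⟶ F_n`. -/
structure MinimalFreeResolution (R : Type u) [CommRing R] [IsLocalRing R]
    (M : Type u) [AddCommGroup M] [Module R M] where
  rank : ℕ → ℕ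
  d : ∀ n : ℕ, (Fin (rank (n + 1)) → R) →ₗ[R] (Fin (rank n) → R)
  aug : (Fin (rank 0) → R) →ₗ[R] M
  aug_surjective : Function.Surjective aug
  exact_zero : Function.Exact (d 0) aug
  exact_succ : ∀ n : ℕ, Function.Exact (d (n + 1)) (d n)
  minimal : ∀ n : ℕ, LinearMap.range (d n) ≤
    IsLocalRing.maximalIdeal R • (⊤ : Submodule R (Fin (rank n) → R))

/-- The `q`-th syzygy of `M` computed from a minimal free resolution `F` of `M`: it is `M` itself
for `q = 0`, and the image of the `q`-th differential `F_q ⟶ F_{q-1}` for `q ≥ 1`. -/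
def MinimalFreeResolution.syzygy {R : Type u} [CommRing R] [IsLocalRing R]
    {M : Type u} [AddCommGroup M] [Module R M] (F : MinimalFreeResolution R M) :
    ℕ → ModuleCat.{u} R
  | 0 => ModuleCat.of R M
  | n + 1 => ModuleCat.of R (LinearMap.range (F.d n))

/-- `M ≅ Ω^q_R M`. Minimal free resolutions of a finitely generated module over a Noetherian local
ring exist and are unique up to isomorphism, so it does not matter which one is used. -/
def IsoSyzygy (R : Type u) [CommRing R] [IsLocalRing R]
    (M : Type u) [AddCommGroup M] [Module R M] (q : ℕ) : Prop :=
  ∃ F : MinimalFreeResolution R M, Nonempty (ModuleCat.of R M ≅ F.syzygy q)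

/-! ### Tor-rigidity -/

/-- `Tor_i^R(M, N) = 0`. Here `Tor_i^R(M, N)` is the homology in degree `i` of `P ⊗ N`, where `P` is
a projective resolution of `M`. -/
def TorVanishes (R : Type u) [CommRing R] (M N : Type u)
    [AddCommGroup M] [Module R M] [AddCommGroup N] [Module R N] (i : ℕ) : Prop :=
  Limits.IsZero (((Tor' (ModuleCat.{u} R) i).obj (ModuleCat.of R M)).obj (ModuleCat.of R N))

/-- The pair `(M, N)` is `n`-Tor-rigid (meant for `n ≥ 1`): for every `r ≥ 1`, if
`Tor_i^R(M, N) = 0` for `i = r, …, r + n - 1`, then `Tor_j^R(M, N) = 0` for all `j ≥ r`. -/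
def IsTorRigidPair (R : Type u) [CommRing R] (n : ℕ) (M N : Type u)
    [AddCommGroup M] [Module R M] [AddCommGroup N] [Module R N] : Prop :=
  ∀ r : ℕ, 1 ≤ r → (∀ i : ℕ, r ≤ i → i < r + n → TorVanishes R M N i) →
    ∀ j : ℕ, r ≤ j → TorVanishes R M N j

/-- `M` is `n`-Tor-rigid: the pair `(M, N)` is `n`-Tor-rigid for every finitely generated
module `N`. -/
def IsNTorRigid (R : Type u) [CommRing R] (n : ℕ) (M : Type u)
    [AddCommGroup M] [Module R M] : Prop :=
  ∀ (N : Type u) [AddCommGroup N] [Module R N] [Module.Finite R N], IsTorRigidPair R n M N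

/-- `M` is Tor-rigid: it is `1`-Tor-rigid. -/
def IsTorRigid (R : Type u) [CommRing R] (M : Type u)
    [AddCommGroup M] [Module R M] : Prop :=
  IsNTorRigid R 1 M

/-! ### The divisor class group

Mathlib's `ClassGroup` consists of *invertible* fractional ideals, hence is the Picard group, which
is trivial over every local domain. The class group of a normal domain is that of Weil divisors. -/

/-- The prime ideals of height one. -/
def PrimeHeightOne (R : Type u) [CommRing R] : Type u :=
  {p : PrimeSpectrum R // p.asIdeal.height = 1}

/-- The order of `x` at a prime `p` of height one, that is, the length of `R_p / x R_p` over `R_p`.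
If `R` is a normal Noetherian domain and `x ≠ 0`, this is the value of `x` under the normalized
discrete valuation of the discrete valuation ring `R_p`. -/
noncomputable def ordAt (R : Type u) [CommRing R] (p : PrimeHeightOne R) (x : R) : ℕ :=
  (Ring.ord (Localization.AtPrime p.1.asIdeal)
    (algebraMap R (Localization.AtPrime p.1.asIdeal) x)).toNat

theorem ordAt_eq_zero_of_notMem (R : Type u) [CommRing R] (p : PrimeHeightOne R) (x : R)
    (hx : x ∉ p.1.asIdeal) : ordAt R p x = 0 := by
  have h : IsUnit (algebraMap R (Localization.AtPrime p.1.asIdeal) x) :=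
    IsLocalization.map_units (Localization.AtPrime p.1.asIdeal)
      (⟨x, hx⟩ : p.1.asIdeal.primeCompl)
  have h2 : Ring.ord (Localization.AtPrime p.1.asIdeal)
      (algebraMap R (Localization.AtPrime p.1.asIdeal) x) = 0 := by
    rw [Ring.ord, Module.length_eq_zero_iff, Ideal.span_singleton_eq_top.2 h]
    exact Ideal.Quotient.subsingleton_iff.2 rfl
  simp [ordAt, h2]

theorem finite_ordAt_ne_zero (R : Type u) [CommRing R] [IsDomain R] [IsNoetherianRing R]
    (x : R) (hx : x ≠ 0) : {p : PrimeHeightOne R | ordAt R p x ≠ 0}.Finite := by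
  refine Set.Finite.of_finite_image (f := fun p => p.1.asIdeal)
    ((Ideal.finite_minimalPrimes_of_isNoetherianRing R (Ideal.span {x})).subset ?_) ?_
  · rintro _ ⟨p, hp, rfl⟩
    have hxp : x ∈ p.1.asIdeal := by
      by_contra h
      exact hp (ordAt_eq_zero_of_notMem R p x h)
    have hle : Ideal.span {x} ≤ p.1.asIdeal := by
      rwa [Ideal.span_singleton_le_iff_mem]
    obtain ⟨q, hq, hqp⟩ := Ideal.exists_minimalPrimes_le hle
    have hqprime : q.IsPrime := hq.1.1
    rcases hqp.eq_or_lt with h | h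
    · have h' : q = p.1.asIdeal := h
      exact (h' ▸ hq : p.1.asIdeal ∈ (Ideal.span {x}).minimalPrimes)
    · exfalso
      have hxq : x ∈ q := hq.1.2 (Ideal.mem_span_singleton_self x)
      have hbot : (⊥ : Ideal R) < q :=
        bot_lt_iff_ne_bot.2 fun h0 => hx (by simpa [h0] using hxq)
      have h1 := Ideal.height_add_one_le_of_lt_of_isPrime hbot
      have h2 := Ideal.height_add_one_le_of_lt_of_isPrime h
      rw [p.2] at h2
      have h3 : (1 : ℕ∞) ≤ q.height := le_trans (by simp) h1
      have h4 : (1 : ℕ∞) + 1 ≤ 1 := le_trans (by gcongr) h2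
      exact absurd h4 (by decide)
  · intro p _ q _ h
    exact Subtype.ext (PrimeSpectrum.ext h)

/-- The group of Weil divisors: the free abelian group on the primes of height one. -/
abbrev WeilDivisor (R : Type u) [CommRing R] : Type u := PrimeHeightOne R →₀ ℤ

/-- The principal divisor `div(x) = ∑ ord_p(x) · p` of a nonzero element `x`. -/
noncomputable def divOf (R : Type u) [CommRing R] [IsDomain R] [IsNoetherianRing R]
    (x : R) (hx : x ≠ 0) : WeilDivisor R :=
  Finsupp.ofSupportFinite (fun p => (ordAt R p x : ℤ)) <|
    (finite_ordAt_ne_zero R x hx).subset fun p hp => by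
      simpa [Function.mem_support] using hp

/-- The subgroup of principal divisors `div(x / y) = div(x) - div(y)`. -/
noncomputable def principalDivisors (R : Type u) [CommRing R] [IsDomain R] [IsNoetherianRing R] :
    AddSubgroup (WeilDivisor R) :=
  AddSubgroup.closure {D | ∃ (x : R) (hx : x ≠ 0), D = divOf R x hx}

/-- The (divisor) class group of a normal Noetherian domain: Weil divisors modulo principal
divisors. -/
abbrev DivisorClassGroup (R : Type u) [CommRing R] [IsDomain R] [IsNoetherianRing R] : Type u :=
  WeilDivisor R ⧸ principalDivisors R

/-- `R` is a two-dimensional normal domain whose divisor class group is torsion. -/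
def IsNormalSurfaceWithTorsionClassGroup (R : Type u) [CommRing R] [IsNoetherianRing R] : Prop :=
  ∃ _ : IsDomain R, IsIntegrallyClosed R ∧ ringKrullDim R = 2 ∧
    ∀ c : DivisorClassGroup R, IsOfFinAddOrder c

/-! Let `M ≅ Ω^q M` with `q` even. Dimension shifting makes the lengths of `Tor_i(M, N)`, `i ≥ 1`,
periodic of period `q`. When they are finite, let `θ(N)` be their alternating sum over one period
(`torTheta`). Then `θ` is additive on short exact sequences: the long exact sequence leaves an error
`c_{i+1} + c_i`, where the `c_i` are lengths of images of connecting maps. Its alternating sum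
telescopes to `c_n - c_{n+q}`, which is the same for every period, and a bounded arithmetic
progression is constant (`alternating_sum_eq_zero_of_bounded`).

Clearly `θ(R) = 0`, so `θ` is a homomorphism `G_0(R)/[R] → ℤ`, and it vanishes because that group is
torsion in all three cases. Hence if `q - 1` consecutive Tors vanish, so does the remaining one in
the period, and periodicity gives the rest.

The vanishing of `θ` is checked on the quotients `R/p`. The residue field is handled by
`residueField_eq_zero`, which settles the Artinian and one-dimensional cases. On a normal surface
`θ` also defines a function on Weil divisors that kills principal ones (`sum_divOf_eq_zero`).

Finite length: at a nonmaximal prime `p` of the domains in question `R_p` is a PID, so the syzygy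
`M` is free there. Some `s ∉ p` then acts on `M` through a free module and kills Tor, so Tor is
supported at the maximal ideal. For Artinian `R` there is no such `p`. -/

section Homological

open MonoidalCategory

/-! ### Tor from minimal resolutions, and its periodicity. -/

namespace MinimalFreeResolution

variable {R : Type u} [CommRing R] [IsLocalRing R] {M : Type u} [AddCommGroup M] [Module R M]

/-- The underlying chain complex of a minimal free resolution. -/
noncomputable def complex (F : MinimalFreeResolution R M) : ChainComplex (ModuleCat.{u} R) ℕ :=
  ChainComplex.of (fun n => ModuleCat.of R (Fin (F.rank n) → R))
    (fun n => ModuleCat.ofHom (F.d n)) fun n => by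
      rw [← ModuleCat.ofHom_comp, (F.exact_succ n).linearMap_comp_eq_zero, ModuleCat.ofHom_zero]

theorem complex_d (F : MinimalFreeResolution R M) (n : ℕ) :
    F.complex.d (n + 1) n = ModuleCat.ofHom (F.d n) :=
  ChainComplex.of_d (fun n => ModuleCat.of R (Fin (F.rank n) → R))
    (fun n => ModuleCat.ofHom (F.d n)) n

theorem complex_d_comp_aug (F : MinimalFreeResolution R M) :
    F.complex.d 1 0 ≫ (ModuleCat.ofHom F.aug : F.complex.X 0 ⟶ ModuleCat.of R M) = 0 := by
  rw [complex_d]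
  exact (ModuleCat.ofHom_comp _ _).symm.trans
    (by rw [F.exact_zero.linearMap_comp_eq_zero, ModuleCat.ofHom_zero]; rfl)

theorem complex_exactAt_succ (F : MinimalFreeResolution R M) (n : ℕ) :
    F.complex.ExactAt (n + 1) := by
  rw [HomologicalComplex.exactAt_iff' _ (n + 1 + 1) (n + 1) n (by simp) (by simp),
    ShortComplex.ShortExact.moduleCat_exact_iff_function_exact]
  have h := F.exact_succ n
  simp only [HomologicalComplex.sc', HomologicalComplex.shortComplexFunctor'_obj_f,
    HomologicalComplex.shortComplexFunctor'_obj_g, complex_d]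
  exact h

instance complex_projective (F : MinimalFreeResolution R M) (n : ℕ) :
    Projective (F.complex.X n) :=
  inferInstanceAs (Projective (ModuleCat.of R (Fin (F.rank n) → R)))

/-- A minimal free resolution as a projective resolution. -/
noncomputable def toProjectiveResolution (F : MinimalFreeResolution R M) :
    ProjectiveResolution (ModuleCat.of R M) where
  complex := F.complex
  π := (ChainComplex.toSingle₀Equiv _ _).symm ⟨ModuleCat.ofHom F.aug, F.complex_d_comp_aug⟩
  quasiIso := ⟨fun n => by
    cases n with
    | zero =>
      rw [ChainComplex.quasiIsoAt₀_iff, ShortComplex.quasiIso_iff_of_zeros']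
      · refine (ShortComplex.exact_and_epi_g_iff_of_iso (S₂ := ShortComplex.mk _ _
          F.complex_d_comp_aug) ?_).2 ⟨?_, (ModuleCat.epi_iff_surjective _).2 F.aug_surjective⟩
        · refine ShortComplex.isoMk (Iso.refl _) (Iso.refl _) (Iso.refl _)
            ((Category.id_comp _).trans (Category.comp_id _).symm)
            ?_
          have h := ChainComplex.toSingle₀Equiv_symm_apply_f_zero (C := F.complex)
            (ModuleCat.ofHom F.aug) F.complex_d_comp_aug
          exact (Category.id_comp _).trans (h.symm.trans (Category.comp_id _).symm)
        · rw [ShortComplex.ShortExact.moduleCat_exact_iff_function_exact]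
          simp only [complex_d]
          exact F.exact_zero
      all_goals rfl
    | succ n =>
      rw [quasiIsoAt_iff_exactAt']
      · exact F.complex_exactAt_succ n
      · exact ChainComplex.exactAt_succ_single_obj _ _⟩

/-- The minimal free resolution of the `(q + 1)`-st syzygy. -/
noncomputable def shift (F : MinimalFreeResolution R M) (q : ℕ) :
    MinimalFreeResolution R (LinearMap.range (F.d q)) where
  rank n := F.rank (q + 1 + n)
  d n := F.d (q + 1 + n)
  aug := (F.d q).rangeRestrict
  aug_surjective := (F.d q).surjective_rangeRestrict
  exact_zero x := by
    rw [← F.exact_succ q x, Subtype.ext_iff]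
    rfl
  exact_succ n := F.exact_succ (q + 1 + n)
  minimal n := F.minimal (q + 1 + n)

/-- The terms of the shifted resolution are those of the original one. -/
noncomputable def shiftXIso (F : MinimalFreeResolution R M) (q n : ℕ) :
    (F.shift q).complex.X n ≅ F.complex.X (q + 1 + n) :=
  Iso.refl (ModuleCat.of R (Fin (F.rank (q + 1 + n)) → R))

theorem shiftXIso_hom_comp_d (F : MinimalFreeResolution R M) (q n : ℕ) :
    (F.shiftXIso q (n + 1)).hom ≫ F.complex.d (q + 1 + n + 1) (q + 1 + n) =
      (F.shift q).complex.d (n + 1) n ≫ (F.shiftXIso q n).hom := by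
  rw [complex_d, complex_d]
  rfl

end MinimalFreeResolution

variable {R : Type u} [CommRing R]

/-- The length of `Tor_i^R(M, N)`. -/
noncomputable def torLength (R : Type u) [CommRing R] (M N : Type u) [AddCommGroup M] [Module R M]
    [AddCommGroup N] [Module R N] (i : ℕ) : ℕ∞ :=
  Module.length R (((Tor' (ModuleCat.{u} R) i).obj (ModuleCat.of R M)).obj (ModuleCat.of R N))

theorem ModuleCat.length_eq_of_iso {X Y : ModuleCat.{u} R} (e : X ≅ Y) :
    Module.length R X = Module.length R Y :=
  e.toLinearEquiv.length_eq

theorem ModuleCat.length_eq_zero_iff_isZero {X : ModuleCat.{u} R} :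
    Module.length R X = 0 ↔ Limits.IsZero X := by
  rw [Module.length_eq_zero_iff, ModuleCat.isZero_iff_subsingleton]

variable (M N : Type u) [AddCommGroup M] [Module R M] [AddCommGroup N] [Module R N]

theorem torVanishes_iff_torLength_eq_zero (i : ℕ) :
    TorVanishes R M N i ↔ torLength R M N i = 0 :=
  ModuleCat.length_eq_zero_iff_isZero.symm

variable {M} in
/-- The complex computing `Tor(M, N)` from a projective resolution of `M`. -/
noncomputable abbrev torComplex (P : ProjectiveResolution (ModuleCat.of R M)) (N : ModuleCat.{u} R) :
    ChainComplex (ModuleCat.{u} R) ℕ :=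
  (((tensoringRight (ModuleCat.{u} R)).obj N).mapHomologicalComplex _).obj P.complex

variable {M} in
/-- `Tor` is computed by any projective resolution of the first argument. -/
noncomputable def torIso (P : ProjectiveResolution (ModuleCat.of R M)) (N : ModuleCat.{u} R)
    (i : ℕ) : ((Tor' (ModuleCat.{u} R) i).obj (ModuleCat.of R M)).obj N ≅
      (torComplex P N).homology i :=
  P.isoLeftDerivedObj ((tensoringRight (ModuleCat.{u} R)).obj N) i

theorem torLength_congr_left {M' : Type u} [AddCommGroup M'] [Module R M']
    (e : ModuleCat.of R M ≅ ModuleCat.of R M') (i : ℕ) :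
    torLength R M N i = torLength R M' N i :=
  ModuleCat.length_eq_of_iso (((Tor' (ModuleCat.{u} R) i).mapIso e).app _)

theorem torLength_eq_zero_of_flat [Module.Flat R N] (i : ℕ) : torLength R M N (i + 1) = 0 := by
  rw [torLength, ModuleCat.length_eq_zero_iff_isZero]
  let P := projectiveResolution (ModuleCat.of R M)
  refine Limits.IsZero.of_iso ?_ (torIso P (ModuleCat.of R N) (i + 1))
  rw [← HomologicalComplex.exactAt_iff_isZero_homology]
  have h := P.complex_exactAt_succ i
  rw [HomologicalComplex.exactAt_iff' _ (i + 1 + 1) (i + 1) i (by simp) (by simp),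
    ShortComplex.ShortExact.moduleCat_exact_iff_function_exact] at h ⊢
  exact Module.Flat.rTensor_exact N h

/-- Truncating a resolution of `M` resolves the syzygy. In positive degrees both homologies are
computed by the same three terms; degree `0` is excluded because the truncation cuts off a
differential there. -/
theorem torLength_syzygy [IsLocalRing R] (F : MinimalFreeResolution R M) (q i : ℕ) :
    torLength R (LinearMap.range (F.d q)) N (i + 1) = torLength R M N (q + 1 + i + 1) := by
  rw [torLength, torLength,
    ModuleCat.length_eq_of_iso (torIso F.toProjectiveResolution _ (q + 1 + i + 1)),
    ModuleCat.length_eq_of_iso (torIso (F.shift q).toProjectiveResolution _ (i + 1))]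
  refine ModuleCat.length_eq_of_iso ?_
  let T := (tensoringRight (ModuleCat.{u} R)).obj (ModuleCat.of R N)
  refine ShortComplex.homologyMapIso
    ((HomologicalComplex.isoSc' (torComplex (F.shift q).toProjectiveResolution _) (i + 1 + 1)
      (i + 1) i (ChainComplex.prev _ _) (ChainComplex.next_nat_succ _)) ≪≫ ?_ ≪≫
    (HomologicalComplex.isoSc' (torComplex F.toProjectiveResolution _) (q + 1 + i + 1 + 1)
      (q + 1 + i + 1) (q + 1 + i) (ChainComplex.prev _ _) (ChainComplex.next_nat_succ _)).symm)
  refine ShortComplex.isoMk (T.mapIso (F.shiftXIso q (i + 1 + 1)))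
    (T.mapIso (F.shiftXIso q (i + 1))) (T.mapIso (F.shiftXIso q i)) ?_ ?_
  · exact (T.map_comp _ _).symm.trans
      ((congrArg T.map (F.shiftXIso_hom_comp_d q (i + 1))).trans (T.map_comp _ _))
  · exact (T.map_comp _ _).symm.trans
      ((congrArg T.map (F.shiftXIso_hom_comp_d q i)).trans (T.map_comp _ _))

theorem torLength_add_of_isoSyzygy [IsLocalRing R] (q : ℕ) (h : IsoSyzygy R M (q + 1)) (i : ℕ) :
    torLength R M N (i + 1 + (q + 1)) = torLength R M N (i + 1) := by
  obtain ⟨F, ⟨e⟩⟩ := h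
  rw [torLength_congr_left M N e (i + 1)]
  refine Eq.trans ?_ (torLength_syzygy M N F q i).symm
  congr 1
  omega

end Homological

/-! ### Long exact sequence in lengths, finiteness and annihilation of Tor. -/

section TorLength

open MonoidalCategory

theorem Module.length_eq_length_range_add_length_range {R A B C : Type*} [CommRing R]
    [AddCommGroup A] [Module R A] [AddCommGroup B] [Module R B] [AddCommGroup C] [Module R C]
    {f : A →ₗ[R] B} {g : B →ₗ[R] C} (h : Function.Exact f g) :
    Module.length R B =
      Module.length R (LinearMap.range f) + Module.length R (LinearMap.range g) := by
  refine Module.length_eq_add_of_exact (LinearMap.range f).subtype g.rangeRestrict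
    (Submodule.injective_subtype _) g.surjective_rangeRestrict fun x => ?_
  rw [← Subtype.coe_inj]
  simpa using h x

theorem LinearMap.length_range_le {R A B : Type*} [CommRing R] [AddCommGroup A] [Module R A]
    [AddCommGroup B] [Module R B] (f : A →ₗ[R] B) :
    Module.length R (LinearMap.range f) ≤ Module.length R A :=
  Module.length_le_of_surjective f.rangeRestrict f.surjective_rangeRestrict

variable {R : Type u} [CommRing R] {M : Type u} [AddCommGroup M] [Module R M]

theorem flat_of_projectiveResolution (P : ProjectiveResolution (ModuleCat.of R M)) (i : ℕ) :
    Module.Flat R (P.complex.X i) := by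
  have : Module.Projective R (P.complex.X i) :=
    (IsProjective.iff_projective _).2 (P.projective i)
  infer_instance

/-- The short complex of complexes induced by a short complex of coefficient modules. -/
noncomputable def torShortComplex (P : ProjectiveResolution (ModuleCat.of R M))
    (S : ShortComplex (ModuleCat.{u} R)) : ShortComplex (ChainComplex (ModuleCat.{u} R) ℕ) where
  X₁ := torComplex P S.X₁
  X₂ := torComplex P S.X₂
  X₃ := torComplex P S.X₃
  f := (NatTrans.mapHomologicalComplex ((tensoringRight _).map S.f) _).app P.complex
  g := (NatTrans.mapHomologicalComplex ((tensoringRight _).map S.g) _).app P.complex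
  zero := by
    ext i : 1
    refine (MonoidalCategory.whiskerLeft_comp _ _ _).symm.trans ?_
    rw [S.zero, MonoidalPreadditive.whiskerLeft_zero]
    rfl

theorem torShortComplex_shortExact (P : ProjectiveResolution (ModuleCat.of R M))
    {S : ShortComplex (ModuleCat.{u} R)} (hS : S.ShortExact) :
    (torShortComplex P S).ShortExact := by
  refine HomologicalComplex.shortExact_of_degreewise_shortExact _ fun i => ?_
  have := flat_of_projectiveResolution P i
  exact ModuleCat.shortComplex_shortExact _
    (Module.Flat.lTensor_exact (P.complex.X i)
      ((ShortComplex.ShortExact.moduleCat_exact_iff_function_exact _).1 hS.exact))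
    (Module.Flat.lTensor_preserves_injective_linearMap S.f.hom hS.moduleCat_injective_f)
    (LinearMap.lTensor_surjective (P.complex.X i) hS.moduleCat_surjective_g)

/-- The long exact sequence of `Tor(M, -)` in terms of lengths; `c i` is the length of the image of
the `i`-th connecting homomorphism. -/
theorem exists_torLength_add_eq_of_exact (M : Type u) [AddCommGroup M] [Module R M]
    {N₁ N₂ N₃ : Type u} [AddCommGroup N₁] [Module R N₁] [AddCommGroup N₂] [Module R N₂]
    [AddCommGroup N₃] [Module R N₃] (f : N₁ →ₗ[R] N₂) (g : N₂ →ₗ[R] N₃)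
    (hf : Function.Injective f) (hg : Function.Surjective g) (hfg : Function.Exact f g) :
    ∃ c : ℕ → ℕ∞, (∀ i, c (i + 1) ≤ torLength R M N₃ (i + 1)) ∧
      ∀ i, torLength R M N₁ (i + 1) + torLength R M N₃ (i + 1) =
        c (i + 2) + c (i + 1) + torLength R M N₂ (i + 1) := by
  let P := projectiveResolution (ModuleCat.of R M)
  let S := ModuleCat.shortComplexOfCompEqZero f g hfg.linearMap_comp_eq_zero
  have hS : S.ShortExact := ModuleCat.shortComplex_shortExact S hfg hf hg
  have hT := torShortComplex_shortExact P hS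
  have h (N : Type u) [AddCommGroup N] [Module R N] (i : ℕ) : torLength R M N i =
      Module.length R ((torComplex P (ModuleCat.of R N)).homology i) :=
    ModuleCat.length_eq_of_iso (torIso P _ i)
  have hrel (i : ℕ) : (ComplexShape.down ℕ).Rel (i + 1) i := rfl
  let c : ℕ → ℕ∞ := fun n => match n with
    | 0 => 0
    | i + 1 => Module.length R (LinearMap.range (hT.δ (i + 1) i (hrel i)).hom)
  refine ⟨c, fun i => ?_, fun i => ?_⟩
  · rw [h N₃]
    exact LinearMap.length_range_le (hT.δ (i + 1) i (hrel i)).hom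
  -- Exactness at the three spots splits each length into two image lengths. Adding the outer two
  -- and substituting the middle one avoids subtraction in `ℕ∞`.
  · have e₁ := Module.length_eq_length_range_add_length_range
      ((ShortComplex.ShortExact.moduleCat_exact_iff_function_exact _).1
        (hT.homology_exact₁ (i + 2) (i + 1) (hrel _)))
    have e₂ := Module.length_eq_length_range_add_length_range
      ((ShortComplex.ShortExact.moduleCat_exact_iff_function_exact _).1
        (hT.homology_exact₂ (i + 1)))
    have e₃ := Module.length_eq_length_range_add_length_range
      ((ShortComplex.ShortExact.moduleCat_exact_iff_function_exact _).1
        (hT.homology_exact₃ (i + 1) i (hrel _)))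
    rw [h N₁, h N₂, h N₃]
    refine (congrArg₂ (· + ·) e₁ e₃).trans ?_
    refine Eq.trans ?_ (congrArg (c (i + 2) + c (i + 1) + ·) e₂).symm
    simp only [c]
    abel

/-- The terms of `F` have finite rank, so Tor is a subquotient of a finite module. -/
theorem tor_finite [IsNoetherianRing R] [IsLocalRing R] (F : MinimalFreeResolution R M)
    (N : Type u) [AddCommGroup N] [Module R N] [Module.Finite R N] (i : ℕ) :
    Module.Finite R
      (((Tor' (ModuleCat.{u} R) i).obj (ModuleCat.of R M)).obj (ModuleCat.of R N)) := by
  let K := torComplex F.toProjectiveResolution (ModuleCat.of R N)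
  have : Module.Finite R (K.X i) :=
    inferInstanceAs (Module.Finite R (TensorProduct R (Fin (F.rank i) → R) N))
  have : Module.Finite R (K.cycles i) :=
    Module.Finite.of_injective (K.iCycles i).hom ((ModuleCat.mono_iff_injective _).1 inferInstance)
  have : Module.Finite R (K.homology i) := Module.Finite.of_surjective (K.homologyπ i).hom
    ((ModuleCat.epi_iff_surjective _).1 inferInstance)
  exact Module.Finite.equiv (torIso F.toProjectiveResolution _ i).symm.toLinearEquiv

/-- Multiplication by `s` on the resolution lifts multiplication by `s` on `M`. -/
theorem tor_map_smul (N : ModuleCat.{u} R) (s : R) (i : ℕ) :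
    ((Tor' (ModuleCat.{u} R) i).map (s • 𝟙 (ModuleCat.of R M))).app N = s • 𝟙 _ := by
  let P := projectiveResolution (ModuleCat.of R M)
  let T := (tensoringRight (ModuleCat.{u} R)).obj N
  have h := T.leftDerived_map_eq i (s • 𝟙 (ModuleCat.of R M)) (P := P) (Q := P) (s • 𝟙 P.complex)
    (by
      ext : 1
      simp only [HomologicalComplex.comp_f, HomologicalComplex.smul_f_apply,
        Linear.smul_comp, Category.id_comp]
      exact ((Linear.comp_smul _ _ _ _ _ _).trans
        (congrArg (s • ·) (Category.comp_id _))).symm)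
  refine h.trans ?_
  have h' : (T.mapHomologicalComplex (ComplexShape.down ℕ) ⋙
      HomologicalComplex.homologyFunctor _ _ i).map (s • 𝟙 P.complex) = s • 𝟙 _ := by
    rw [Functor.comp_map, Functor.map_smul, CategoryTheory.Functor.map_id]
    refine (ShortComplex.homologyMap_smul (𝟙 _) s).trans ?_
    rw [ShortComplex.homologyMap_id]
    rfl
  rw [h', Linear.smul_comp]
  refine (Linear.comp_smul _ _ _ _ _ _).trans (congrArg (s • ·) ?_)
  exact (congrArg ((P.isoLeftDerivedObj T i).hom ≫ ·) (Category.id_comp _)).trans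
    (Iso.hom_inv_id _)

/-- By functoriality `s` acts on Tor through the higher Tor of a projective module. -/
theorem smul_tor_eq_zero_of_factors {L : Type u} [AddCommGroup L] [Module R L]
    [Module.Projective R L] (N : Type u) [AddCommGroup N] [Module R N] {s : R}
    (g : M →ₗ[R] L) (f : L →ₗ[R] M) (h : f ∘ₗ g = s • LinearMap.id) (i : ℕ)
    (x : ((Tor' (ModuleCat.{u} R) (i + 1)).obj (ModuleCat.of R M)).obj (ModuleCat.of R N)) :
    s • x = 0 := by
  have hL : Limits.IsZero
      (((Tor' (ModuleCat.{u} R) (i + 1)).obj (ModuleCat.of R L)).obj (ModuleCat.of R N)) :=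
    haveI : Projective (ModuleCat.of R L) := (IsProjective.iff_projective _).1 inferInstance
    isZero_Tor'_succ_of_projective _ _ _ _
  have e : s • 𝟙 (ModuleCat.of R M) = ModuleCat.ofHom g ≫ ModuleCat.ofHom f := by
    rw [← ModuleCat.ofHom_comp, h]
    rfl
  have := tor_map_smul (M := M) (ModuleCat.of R N) s (i + 1)
  rw [e, Functor.map_comp, NatTrans.comp_app,
    hL.eq_zero_of_tgt (((Tor' (ModuleCat.{u} R) (i + 1)).map (ModuleCat.ofHom g)).app _), Limits.zero_comp] at this
  exact (congrArg (fun φ => φ.hom x) this).symm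

end TorLength

/-! ### Additive functions on finitely generated modules. -/

section Additive

open IsLocalRing

theorem Module.length_quotient_maximalIdeal (R : Type*) [CommRing R] [IsLocalRing R] :
    Module.length R (R ⧸ maximalIdeal R) = 1 := by
  rw [Module.length_eq_one_iff]
  exact isSimpleModule_iff_isCoatom.2 (maximalIdeal.isMaximal R).out

/-- A finitely generated module over a Noetherian local ring which is supported only at the
maximal ideal has finite length. -/
theorem Module.length_ne_top_of_forall_prime_exists_smul_eq_zero {R : Type*} [CommRing R]
    [IsNoetherianRing R] [IsLocalRing R] {N : Type*} [AddCommGroup N] [Module R N]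
    [Module.Finite R N]
    (h : ∀ p : Ideal R, p.IsPrime → p ≠ maximalIdeal R → ∃ s ∉ p, ∀ x : N, s • x = 0) :
    Module.length R N ≠ ⊤ := by
  revert h
  induction ‹Module.Finite R N› using
    IsNoetherianRing.induction_on_isQuotientEquivQuotientPrime R with
  | subsingleton N => simp [Module.length_eq_zero]
  | quotient N p e =>
    intro h
    have hp : p.1 = maximalIdeal R := by
      by_contra hp
      obtain ⟨s, hs, hs'⟩ := h p.1 p.2 hp
      have := congrArg e (hs' (e.symm 1))
      rw [map_smul, e.apply_symm_apply, map_zero, Algebra.smul_def, mul_one] at this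
      exact hs (Ideal.Quotient.eq_zero_iff_mem.1 this)
    rw [e.length_eq, hp, Module.length_quotient_maximalIdeal]
    simp
  | exact N₁ N₂ N₃ f g hf hg hfg h₁ h₃ =>
    intro h
    rw [Module.length_eq_add_of_exact f g hf hg hfg]
    refine WithTop.add_ne_top.2 ⟨h₁ fun p hp hpm => ?_, h₃ fun p hp hpm => ?_⟩
    · obtain ⟨s, hs, hs'⟩ := h p hp hpm
      exact ⟨s, hs, fun x => hf (by rw [map_smul, hs', map_zero])⟩
    · obtain ⟨s, hs, hs'⟩ := h p hp hpm
      refine ⟨s, hs, fun x => ?_⟩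
      obtain ⟨y, rfl⟩ := hg x
      rw [← map_smul, hs', map_zero]

variable {R : Type u} [CommRing R]

/-- An integer-valued function on modules which is additive on short exact sequences of finitely
generated modules. -/
def IsAdditiveOnFinite (R : Type u) [CommRing R]
    (θ : (N : Type u) → [AddCommGroup N] → [Module R N] → ℤ) : Prop :=
  ∀ (N₁ N₂ N₃ : Type u) [AddCommGroup N₁] [Module R N₁] [AddCommGroup N₂] [Module R N₂]
    [AddCommGroup N₃] [Module R N₃] [Module.Finite R N₁] [Module.Finite R N₂] [Module.Finite R N₃]
    (f : N₁ →ₗ[R] N₂) (g : N₂ →ₗ[R] N₃), Function.Injective f → Function.Surjective g →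
    Function.Exact f g → θ N₂ = θ N₁ + θ N₃

namespace IsAdditiveOnFinite

variable {θ : (N : Type u) → [AddCommGroup N] → [Module R N] → ℤ} (h : IsAdditiveOnFinite R θ)

include h

theorem eq_zero_of_subsingleton (N : Type u) [AddCommGroup N] [Module R N] [Subsingleton N] :
    θ N = 0 := by
  have := h N N N 0 0 (Function.injective_of_subsingleton _)
    (Function.surjective_to_subsingleton _) fun x => by simp [Subsingleton.elim x 0]
  omega

theorem eq_of_equiv {N N' : Type u} [AddCommGroup N] [Module R N] [AddCommGroup N'] [Module R N']
    [Module.Finite R N] (e : N ≃ₗ[R] N') : θ N = θ N' := by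
  have : Module.Finite R N' := Module.Finite.equiv e
  have := h N N' PUnit.{u + 1} e.toLinearMap 0 e.injective (Function.surjective_to_subsingleton _)
    ((LinearMap.exact_zero_iff_surjective _ _).2 e.surjective)
  rw [this, h.eq_zero_of_subsingleton PUnit, add_zero]

theorem eq_zero_of_forall_prime [IsNoetherianRing R]
    (hp : ∀ p : Ideal R, p.IsPrime → θ (R ⧸ p) = 0)
    (N : Type u) [AddCommGroup N] [Module R N] [Module.Finite R N] : θ N = 0 := by
  induction ‹Module.Finite R N› using
    IsNoetherianRing.induction_on_isQuotientEquivQuotientPrime R with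
  | subsingleton N => exact h.eq_zero_of_subsingleton N
  | quotient N p e => rw [h.eq_of_equiv e, hp p.1 p.2]
  | exact N₁ N₂ N₃ f g hf hg hfg h₁ h₃ => rw [h N₁ N₂ N₃ f g hf hg hfg, h₁, h₃, add_zero]

theorem eq_zero_of_regular_quotient {N : Type u} [AddCommGroup N] [Module R N] [Module.Finite R N]
    {N' : Type u} [AddCommGroup N'] [Module R N'] [Module.Finite R N']
    (f : N →ₗ[R] N) (g : N →ₗ[R] N') (hf : Function.Injective f) (hg : Function.Surjective g)
    (hfg : Function.Exact f g) : θ N' = 0 := by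
  have := h N N N' f g hf hg hfg
  omega

variable [IsNoetherianRing R] [IsLocalRing R]

/-- In a prime filtration of a finite-length module every factor is the residue field, since an
Artinian domain is a field. -/
theorem eq_length_mul (N : Type u) [AddCommGroup N] [Module R N] [Module.Finite R N]
    (hN : Module.length R N ≠ ⊤) :
    θ N = (Module.length R N).toNat * θ (R ⧸ maximalIdeal R) := by
  revert hN
  induction ‹Module.Finite R N› using
    IsNoetherianRing.induction_on_isQuotientEquivQuotientPrime R with
  | subsingleton N => simp [Module.length_eq_zero, h.eq_zero_of_subsingleton]
  | quotient N p e =>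
    intro hN
    have : IsArtinian R (R ⧸ p.1) := by
      rw [e.length_eq, Module.length_ne_top_iff,
        isFiniteLength_iff_isNoetherian_isArtinian] at hN
      exact hN.2
    have : IsArtinianRing (R ⧸ p.1) := isArtinian_of_tower R this
    have := p.2
    have hp : p.1 = maximalIdeal R :=
      eq_maximalIdeal (Ideal.Quotient.maximal_of_isField _ (IsArtinianRing.isField_of_isDomain _))
    rw [h.eq_of_equiv e, e.length_eq, hp, Module.length_quotient_maximalIdeal]
    simp
  | exact N₁ N₂ N₃ f g hf hg hfg h₁ h₃ =>
    intro hN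
    rw [Module.length_eq_add_of_exact f g hf hg hfg] at hN ⊢
    obtain ⟨k₁, k₃⟩ := WithTop.add_ne_top.1 hN
    rw [h N₁ N₂ N₃ f g hf hg hfg, h₁ k₁, h₃ k₃, ENat.toNat_add k₁ k₃]
    push_cast
    ring

/-- As `ℤ` is torsion-free, one nonzero module of finite length with `θ = 0` suffices, by
`eq_length_mul`. -/
theorem residueField_eq_zero (hR : θ R = 0) : θ (R ⧸ maximalIdeal R) = 0 := by
  suffices ∃ (N : Type u) (_ : AddCommGroup N) (_ : Module R N) (_ : Module.Finite R N),
      Nontrivial N ∧ Module.length R N ≠ ⊤ ∧ θ N = 0 by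
    obtain ⟨N, _, _, _, _, hN, hθ⟩ := this
    rw [h.eq_length_mul N hN, mul_eq_zero] at hθ
    refine hθ.resolve_left fun h0 => ?_
    have : (Module.length R N).toNat = 0 := by exact_mod_cast h0
    rw [ENat.toNat_eq_zero] at this
    exact this.elim (Module.length_pos (R := R) (M := N)).ne' hN
  by_cases hm : ∃ p : Ideal R, p.IsPrime ∧ p ≠ maximalIdeal R
  -- Take `p` maximal among the nonmaximal primes and `y` outside it. Then `R/(p + (y))` is
  -- supported only at the maximal ideal, and it is the cokernel of the injection `y` on `R/p`.
  · obtain ⟨p, ⟨hp, hpm⟩, hmax⟩ :=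
      set_has_maximal_iff_noetherian.2 ‹IsNoetherianRing R›
        {p : Ideal R | p.IsPrime ∧ p ≠ maximalIdeal R} hm
    have hlt : p < maximalIdeal R := lt_of_le_of_ne (le_maximalIdeal hp.ne_top) hpm
    obtain ⟨y, hym, hyp⟩ := SetLike.exists_of_lt hlt
    let I := p ⊔ Ideal.span {y}
    have hI : I ≤ maximalIdeal R :=
      sup_le hlt.le ((Ideal.span_singleton_le_iff_mem _).2 hym)
    refine ⟨R ⧸ I, inferInstance, inferInstance, inferInstance,
      Ideal.Quotient.nontrivial_iff.2 (hI.trans_lt (maximalIdeal.isMaximal R).ne_top.lt_top).ne,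
      ?_, ?_⟩
    · refine Module.length_ne_top_of_forall_prime_exists_smul_eq_zero fun q hq hqm => ?_
      have : ¬ I ≤ q := fun hIq => hmax q ⟨hq, hqm⟩ (lt_of_le_of_ne (le_sup_left.trans hIq)
        fun hpq => hyp (hpq ▸ hIq (Ideal.mem_sup_right (Ideal.mem_span_singleton_self y))))
      obtain ⟨s, hsI, hsq⟩ := SetLike.not_le_iff_exists.1 this
      refine ⟨s, hsq, fun x => ?_⟩
      rw [Algebra.smul_def, Ideal.Quotient.algebraMap_eq, Ideal.Quotient.eq_zero_iff_mem.2 hsI,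
        zero_mul]
    · refine h.eq_zero_of_regular_quotient (N := R ⧸ p) (y • LinearMap.id)
        (Submodule.factor (le_sup_left : p ≤ I)) ?_ (Submodule.factor_surjective _) ?_
      · rw [injective_iff_map_eq_zero]
        intro x hx
        obtain ⟨x, rfl⟩ := Ideal.Quotient.mk_surjective x
        have : y * x ∈ p := Ideal.Quotient.eq_zero_iff_mem.1 hx
        exact Ideal.Quotient.eq_zero_iff_mem.2 ((hp.mem_or_mem this).resolve_left hyp)
      · intro x
        obtain ⟨x, rfl⟩ := Ideal.Quotient.mk_surjective x
        have hxI : Submodule.factor (le_sup_left : p ≤ I) (Ideal.Quotient.mk p x) = 0 ↔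
            x ∈ Ideal.span {y} ⊔ p := by
          rw [sup_comm (Ideal.span {y}) p]
          exact Ideal.Quotient.eq_zero_iff_mem (I := I)
        rw [hxI, Ideal.mem_span_singleton_sup]
        constructor
        · rintro ⟨a, b, hb, rfl⟩
          refine ⟨Ideal.Quotient.mk p a, (Ideal.Quotient.eq (I := p) (x := y * a)).2 ?_⟩
          rw [mul_comm, sub_add_cancel_left]
          exact neg_mem hb
        · rintro ⟨a, ha⟩
          obtain ⟨a, rfl⟩ := Ideal.Quotient.mk_surjective a
          have : y * a - x ∈ p := (Ideal.Quotient.eq (I := p)).1 ha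
          exact ⟨a, x - y * a, by rw [← neg_sub]; exact neg_mem this, by ring⟩
  -- Without nonmaximal primes `R` itself has finite length.
  · push Not at hm
    exact ⟨R, inferInstance, inferInstance, inferInstance, inferInstance,
      Module.length_ne_top_of_forall_prime_exists_smul_eq_zero fun p hp hpm =>
        absurd (hm p hp) hpm, hR⟩

end IsAdditiveOnFinite

end Additive

/-! ### Freeness on the punctured spectrum. -/

section LocallyFree

open IsLocalRing

variable {R : Type u} [CommRing R]

/-- Multiplication by `s` on `M` factors through a finite free module. -/
def FactorsThroughFree (M : Type*) [AddCommGroup M] [Module R M] (s : R) : Prop :=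
  ∃ (n : ℕ) (g : M →ₗ[R] (Fin n → R)) (f : (Fin n → R) →ₗ[R] M), f ∘ₗ g = s • LinearMap.id

theorem FactorsThroughFree.of_equiv {M M' : Type*} [AddCommGroup M] [Module R M]
    [AddCommGroup M'] [Module R M'] (e : M ≃ₗ[R] M') {s : R} (h : FactorsThroughFree M' s) :
    FactorsThroughFree M s := by
  obtain ⟨n, g, f, hfg⟩ := h
  refine ⟨n, g ∘ₗ e, e.symm ∘ₗ f, LinearMap.ext fun x => ?_⟩
  have := LinearMap.congr_fun hfg (e x)
  simp only [LinearMap.comp_apply, LinearMap.smul_apply, LinearMap.id_apply] at this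
  simp [this]

/-- A local isomorphism with a free module and its inverse both lift to `R` after clearing the
denominators `s₁` and `s₂`. -/
theorem exists_factorsThroughFree_of_free_localization {M : Type*} [AddCommGroup M] [Module R M]
    [Module.FinitePresentation R M] (p : Ideal R) [p.IsPrime]
    {M' : Type*} [AddCommGroup M'] [Module R M'] [Module (Localization.AtPrime p) M']
    [IsScalarTower R (Localization.AtPrime p) M'] (m : M →ₗ[R] M')
    [IsLocalizedModule p.primeCompl m] [Module.Free (Localization.AtPrime p) M'] :
    ∃ s ∉ p, FactorsThroughFree M s := by
  let S := p.primeCompl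
  let n := Module.finrank (Localization.AtPrime p) M'
  let a := LocalizedModule.mkLinearMap S (Fin n → R)
  have : Module.Finite (Localization.AtPrime p) M' := Module.Finite.of_isLocalizedModule S m
  have : Module.Finite (Localization.AtPrime p) (LocalizedModule S (Fin n → R)) :=
    Module.Finite.of_isLocalizedModule S a
  have : Module.Free (Localization.AtPrime p) (LocalizedModule S (Fin n → R)) :=
    Module.free_of_isLocalizedModule S a
  have e : M' ≃ₗ[Localization.AtPrime p] LocalizedModule S (Fin n → R) :=
    LinearEquiv.ofFinrankEq _ _ (by
      rw [Module.finrank_of_isLocalizedModule_of_free (Localization.AtPrime p) S a]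
      have := (algebraMap R (Localization.AtPrime p)).domain_nontrivial
      rw [Module.finrank_fin_fun])
  let e' := e.restrictScalars R
  obtain ⟨g, s₁, hg⟩ := Module.FinitePresentation.exists_lift_of_isLocalizedModule S a
    (e'.toLinearMap ∘ₗ m)
  obtain ⟨f, s₂, hf⟩ := Module.FinitePresentation.exists_lift_of_isLocalizedModule S m
    (e'.symm.toLinearMap ∘ₗ a)
  have h : m ∘ₗ (f ∘ₗ g) = m ∘ₗ ((s₂ * s₁ : S) • LinearMap.id) := by
    ext x
    have h₁ := LinearMap.congr_fun hg x
    have h₂ := LinearMap.congr_fun hf (g x)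
    simp only [LinearMap.comp_apply, LinearMap.smul_apply, LinearEquiv.coe_coe, LinearMap.id_apply,
      Submonoid.smul_def, map_smul, mul_smul] at h₁ h₂ ⊢
    rw [h₂, h₁, map_smul, LinearEquiv.symm_apply_apply]
  -- The lifts compose to `s₂ * s₁` only after localizing; `s₃` makes the identity hold on `M`.
  obtain ⟨s₃, hs₃⟩ := Module.Finite.exists_smul_of_comp_eq_of_isLocalizedModule S m _ _ h
  refine ⟨(s₃ * (s₂ * s₁) : S), (s₃ * (s₂ * s₁) : S).2, n, g, (s₃ : R) • f, ?_⟩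
  rw [LinearMap.smul_comp, Submonoid.coe_mul, mul_smul]
  exact hs₃

/-- Over a PID, a submodule of a finite free module is free. -/
theorem exists_factorsThroughFree_of_isPrincipalIdealRing [IsDomain R] [IsNoetherianRing R] {k : ℕ}
    (K : Submodule R (Fin k → R)) (p : Ideal R) [p.IsPrime]
    [IsPrincipalIdealRing (Localization.AtPrime p)] : ∃ s ∉ p, FactorsThroughFree K s := by
  let a := LocalizedModule.mkLinearMap p.primeCompl (Fin k → R)
  have : Module.Free (Localization.AtPrime p) (LocalizedModule p.primeCompl (Fin k → R)) :=
    Module.free_of_isLocalizedModule p.primeCompl a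
  have : Module.Finite (Localization.AtPrime p) (LocalizedModule p.primeCompl (Fin k → R)) :=
    Module.Finite.of_isLocalizedModule p.primeCompl a
  obtain ⟨n, ⟨b⟩⟩ := Submodule.nonempty_basis_of_pid
    (Module.Free.chooseBasis (Localization.AtPrime p) (LocalizedModule p.primeCompl (Fin k → R)))
    (K.localized' (Localization.AtPrime p) p.primeCompl a)
  have := Module.Free.of_basis b
  have : Module.FinitePresentation R K := Module.finitePresentation_of_finite R K
  exact exists_factorsThroughFree_of_free_localization p
    (M' := K.localized' (Localization.AtPrime p) p.primeCompl a)
    (K.toLocalized' (Localization.AtPrime p) p.primeCompl a)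

theorem isPrincipalIdealRing_localization_bot [IsDomain R] [IsNoetherianRing R] {p : Ideal R}
    [p.IsPrime] (hp : p = ⊥) : IsPrincipalIdealRing (Localization.AtPrime p) := by
  have : IsNoetherianRing (Localization.AtPrime p) :=
    IsLocalization.isNoetherianRing p.primeCompl _ ‹_›
  refine ((tfae_of_isNoetherianRing_of_isLocalRing_of_isDomain (Localization.AtPrime p)).out 0 4).2
    ?_
  rw [← Localization.AtPrime.map_eq_maximalIdeal,
    (congrArg (Ideal.map (algebraMap R (Localization.AtPrime p))) hp).trans Ideal.map_bot]
  infer_instance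

theorem Ideal.eq_of_le_of_height_eq_one [IsDomain R] {p q : Ideal R} [p.IsPrime] [q.IsPrime]
    (hp : p.height = 1) (hq : q ≠ ⊥) (hqp : q ≤ p) : q = p := by
  by_contra hne
  have h₁ := Ideal.height_add_one_le_of_lt_of_isPrime (bot_lt_iff_ne_bot.2 hq)
  have h₂ := Ideal.height_add_one_le_of_lt_of_isPrime (lt_of_le_of_ne hqp hne)
  rw [hp] at h₂
  have h₃ : (1 : ℕ∞) ≤ q.height := le_trans (by simp) h₁
  exact absurd (le_trans (by gcongr) h₂ : (1 : ℕ∞) + 1 ≤ 1) (by decide)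

theorem isPrincipalIdealRing_localization_of_height_eq_one [IsDomain R] [IsNoetherianRing R]
    [IsIntegrallyClosed R] {p : Ideal R} [p.IsPrime] (hp : p.height = 1) :
    IsPrincipalIdealRing (Localization.AtPrime p) := by
  have : IsNoetherianRing (Localization.AtPrime p) :=
    IsLocalization.isNoetherianRing p.primeCompl _ ‹_›
  have h := (tfae_of_isNoetherianRing_of_isLocalRing_of_isDomain (Localization.AtPrime p)).out 0 3
  refine h.2
    ⟨isIntegrallyClosed_of_isLocalization _ p.primeCompl p.primeCompl_le_nonZeroDivisors,
      fun P hP hPp => ?_⟩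
  have hle : P.under R ≤ p := (Ideal.comap_mono (le_maximalIdeal hPp.ne_top)).trans
    (IsLocalization.AtPrime.under_maximalIdeal (Localization.AtPrime p) p).le
  have hne : P.under R ≠ ⊥ := fun h => hP (by
    rw [← IsLocalization.map_under p.primeCompl (Localization.AtPrime p) P, h, Ideal.map_bot])
  rw [← IsLocalization.map_under p.primeCompl (Localization.AtPrime p) P,
    Ideal.eq_of_le_of_height_eq_one hp hne hle, Localization.AtPrime.map_eq_maximalIdeal]

theorem Ideal.height_eq_one_of_ringKrullDim_eq_two [IsDomain R] [IsLocalRing R]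
    (hR : ringKrullDim R = 2) {p : Ideal R} [p.IsPrime] (hp : p ≠ ⊥) (hpm : p ≠ maximalIdeal R) :
    p.height = 1 := by
  have h₁ := Ideal.height_add_one_le_of_lt_of_isPrime (bot_lt_iff_ne_bot.2 hp)
  have h₂ := Ideal.height_add_one_le_of_lt_of_isPrime
    (lt_of_le_of_ne (le_maximalIdeal (‹p.IsPrime›.ne_top)) hpm)
  have h₃ : (maximalIdeal R).height = 2 := by
    have := maximalIdeal_height_eq_ringKrullDim (R := R)
    exact WithBot.coe_inj.1 (this.trans hR)
  rw [h₃, ← one_add_one_eq_two, ENat.add_le_add_iff_right ENat.one_ne_top] at h₂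
  exact le_antisymm h₂ (le_trans (by simp) h₁)

theorem eq_bot_of_ringKrullDim_eq_one [IsDomain R] [IsLocalRing R]
    (hR : ringKrullDim R = 1) {p : Ideal R} [p.IsPrime] (hpm : p ≠ maximalIdeal R) :
    p = ⊥ := by
  have h₂ := Ideal.height_add_one_le_of_lt_of_isPrime
    (lt_of_le_of_ne (le_maximalIdeal (‹p.IsPrime›.ne_top)) hpm)
  have h₃ : (maximalIdeal R).height = 1 := by
    have := maximalIdeal_height_eq_ringKrullDim (R := R)
    rw [hR] at this
    exact_mod_cast this
  rw [h₃] at h₂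
  rw [← Ideal.height_eq_zero_iff_eq_bot]
  by_contra h
  have := le_trans (add_le_add_left (Order.one_le_iff_ne_zero.2 h) 1) h₂
  exact absurd this (by decide)

end LocallyFree

/-! ### Local lengths, and vanishing of additive functions in the three cases. -/

section TorsionClassGroup

open IsLocalRing

variable {R : Type u} [CommRing R]

/-- The length of the localization of a module at a prime ideal. -/
noncomputable def localLength (p : Ideal R) [p.IsPrime] (N : Type*) [AddCommGroup N] [Module R N] :
    ℕ∞ :=
  Module.length (Localization.AtPrime p) (LocalizedModule p.primeCompl N)

theorem localLength_congr (p : Ideal R) [p.IsPrime] {N N' : Type*} [AddCommGroup N] [Module R N]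
    [AddCommGroup N'] [Module R N'] (e : N ≃ₗ[R] N') : localLength p N = localLength p N' :=
  (IsLocalizedModule.linearEquiv p.primeCompl (LocalizedModule.mkLinearMap p.primeCompl N)
    (LocalizedModule.mkLinearMap p.primeCompl N' ∘ₗ e.toLinearMap)
      |>.extendScalarsOfIsLocalization p.primeCompl (Localization.AtPrime p)).length_eq

theorem localLength_eq_add_of_exact (p : Ideal R) [p.IsPrime] {N₁ N₂ N₃ : Type*}
    [AddCommGroup N₁] [Module R N₁] [AddCommGroup N₂] [Module R N₂]
    [AddCommGroup N₃] [Module R N₃] (f : N₁ →ₗ[R] N₂) (g : N₂ →ₗ[R] N₃)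
    (hf : Function.Injective f) (hg : Function.Surjective g) (hfg : Function.Exact f g) :
    localLength p N₂ = localLength p N₁ + localLength p N₃ :=
  Module.length_eq_add_of_exact
    ((IsLocalizedModule.map p.primeCompl (LocalizedModule.mkLinearMap p.primeCompl N₁)
      (LocalizedModule.mkLinearMap p.primeCompl N₂) f).extendScalarsOfIsLocalization
        p.primeCompl (Localization.AtPrime p))
    ((IsLocalizedModule.map p.primeCompl (LocalizedModule.mkLinearMap p.primeCompl N₂)
      (LocalizedModule.mkLinearMap p.primeCompl N₃) g).extendScalarsOfIsLocalization
        p.primeCompl (Localization.AtPrime p))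
    (IsLocalizedModule.map_injective _ _ _ _ hf) (IsLocalizedModule.map_surjective _ _ _ _ hg)
    (IsLocalizedModule.map_exact _ _ _ _ _ _ hfg)

theorem localLength_eq_zero_of_subsingleton (p : Ideal R) [p.IsPrime] (N : Type*) [AddCommGroup N]
    [Module R N] [Subsingleton N] : localLength p N = 0 :=
  Module.length_eq_zero_iff.2 inferInstance

theorem localLength_quotient (p : Ideal R) [p.IsPrime] (I : Ideal R) :
    localLength p (R ⧸ I) = Module.length (Localization.AtPrime p)
      (Localization.AtPrime p ⧸ I.map (algebraMap R (Localization.AtPrime p))) := by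
  let A := Localization.AtPrime p
  let a := Algebra.linearMap R A
  have e := (IsLocalizedModule.linearEquiv p.primeCompl
    (LocalizedModule.mkLinearMap p.primeCompl (R ⧸ I))
    (Submodule.toLocalizedQuotient' A p.primeCompl a I)).extendScalarsOfIsLocalization
      p.primeCompl A
  have h : Submodule.localized' A p.primeCompl a I = I.map (algebraMap R A) :=
    Submodule.localized'_eq_span ..
  refine e.length_eq.trans ?_
  rw [h]

theorem localLength_quotient_self (p : Ideal R) [p.IsPrime] : localLength p (R ⧸ p) = 1 := by
  rw [localLength_quotient, Localization.AtPrime.map_eq_maximalIdeal,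
    Module.length_quotient_maximalIdeal]

theorem localLength_quotient_of_not_le (p : Ideal R) [p.IsPrime] {I : Ideal R} (h : ¬ I ≤ p) :
    localLength p (R ⧸ I) = 0 := by
  obtain ⟨s, hsI, hsp⟩ := SetLike.not_le_iff_exists.1 h
  rw [localLength_quotient, Module.length_eq_zero_iff, Ideal.Quotient.subsingleton_iff]
  exact Ideal.eq_top_of_isUnit_mem _ (Ideal.mem_map_of_mem _ hsI)
    (IsLocalization.map_units (Localization.AtPrime p) (⟨s, hsp⟩ : p.primeCompl))

theorem localLength_quotient_span_singleton (p : Ideal R) [p.IsPrime] (x : R) :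
    localLength p (R ⧸ Ideal.span {x}) =
      Ring.ord (Localization.AtPrime p) (algebraMap R (Localization.AtPrime p) x) := by
  rw [localLength_quotient, Ideal.map_span, Set.image_singleton, Ring.ord]

theorem IsAdditiveOnFinite.eq_zero_of_ringKrullDim_eq_one [IsDomain R] [IsNoetherianRing R]
    [IsLocalRing R] (hdim : ringKrullDim R = 1)
    {θ : (N : Type u) → [AddCommGroup N] → [Module R N] → ℤ} (h : IsAdditiveOnFinite R θ)
    (hR : θ R = 0) (N : Type u) [AddCommGroup N] [Module R N] [Module.Finite R N] : θ N = 0 := by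
  refine h.eq_zero_of_forall_prime (fun p hp => ?_) N
  by_cases hpm : p = maximalIdeal R
  · rw [hpm, h.residueField_eq_zero hR]
  · rw [eq_bot_of_ringKrullDim_eq_one hdim hpm,
      ← h.eq_of_equiv (Submodule.quotEquivOfEqBot (⊥ : Ideal R) rfl).symm, hR]

theorem IsAdditiveOnFinite.eq_zero_of_isArtinianRing [IsArtinianRing R]
    [IsLocalRing R] {θ : (N : Type u) → [AddCommGroup N] → [Module R N] → ℤ}
    (h : IsAdditiveOnFinite R θ) (hR : θ R = 0) (N : Type u) [AddCommGroup N] [Module R N]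
    [Module.Finite R N] : θ N = 0 := by
  refine h.eq_zero_of_forall_prime (fun p hp => ?_) N
  rw [eq_maximalIdeal (IsArtinianRing.isMaximal_of_isPrime p), h.residueField_eq_zero hR]

section Surface

variable [IsDomain R] [IsNoetherianRing R]

/-- Primes in a filtration of `N` contain `x ≠ 0`, so the only one surviving localization at `p` is
`p` itself. -/
theorem localLength_ne_top_of_smul_eq_zero {x : R} (hx : x ≠ 0) (p : PrimeHeightOne R)
    (N : Type u) [AddCommGroup N] [Module R N] [Module.Finite R N] (hN : ∀ n : N, x • n = 0) :
    localLength p.1.asIdeal N ≠ ⊤ := by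
  revert hN
  induction ‹Module.Finite R N› using
    IsNoetherianRing.induction_on_isQuotientEquivQuotientPrime R with
  | subsingleton N => simp [localLength_eq_zero_of_subsingleton]
  | quotient N q e =>
    intro hN
    rw [localLength_congr _ e]
    by_cases hq : q.1 ≤ p.1.asIdeal
    · have hxq : x ∈ q.1 := by
        have := congrArg e (hN (e.symm 1))
        rw [map_smul, e.apply_symm_apply, map_zero, Algebra.smul_def, mul_one] at this
        exact Ideal.Quotient.eq_zero_iff_mem.1 this
      have := q.2
      have hqp : q.1 = p.1.asIdeal := Ideal.eq_of_le_of_height_eq_one p.2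
        (fun h0 => hx (by simpa [h0] using hxq)) hq
      rw [hqp, localLength_quotient_self]
      simp
    · rw [localLength_quotient_of_not_le _ hq]
      simp
  | exact N₁ N₂ N₃ f g hf hg hfg h₁ h₃ =>
    intro hN
    rw [localLength_eq_add_of_exact _ f g hf hg hfg]
    refine WithTop.add_ne_top.2 ⟨h₁ fun n => hf (by rw [map_smul, hN, map_zero]), h₃ fun n => ?_⟩
    obtain ⟨y, rfl⟩ := hg n
    rw [← map_smul, hN, map_zero]

variable [IsLocalRing R] {θ : (N : Type u) → [AddCommGroup N] → [Module R N] → ℤ}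
  (h : IsAdditiveOnFinite R θ) (hdim : ringKrullDim R = 2) (hR : θ R = 0)

include h hdim hR

/-- Both sides are additive on modules killed by `x`, which leaves `R/q` with `x ∈ q`. If `q` is
maximal both sides vanish; otherwise `q` has height one and only its own term remains. -/
theorem IsAdditiveOnFinite.eq_sum_localLength {x : R} (hx : x ≠ 0) (S : Finset (PrimeHeightOne R))
    (hS : ∀ p : PrimeHeightOne R, x ∈ p.1.asIdeal → p ∈ S)
    (N : Type u) [AddCommGroup N] [Module R N] [Module.Finite R N] (hN : ∀ n : N, x • n = 0) :
    θ N = ∑ p ∈ S, ((localLength p.1.asIdeal N).toNat : ℤ) * θ (R ⧸ p.1.asIdeal) := by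
  revert hN
  induction ‹Module.Finite R N› using
    IsNoetherianRing.induction_on_isQuotientEquivQuotientPrime R with
  | subsingleton N => simp [localLength_eq_zero_of_subsingleton, h.eq_zero_of_subsingleton]
  | quotient N q e =>
    intro hN
    simp only [localLength_congr _ e]
    have hxq : x ∈ q.1 := by
      have := congrArg e (hN (e.symm 1))
      rw [map_smul, e.apply_symm_apply, map_zero, Algebra.smul_def, mul_one] at this
      exact Ideal.Quotient.eq_zero_iff_mem.1 this
    have hqprime := q.2
    have hq0 : q.1 ≠ ⊥ := fun h0 => hx (by simpa [h0] using hxq)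
    rw [h.eq_of_equiv e]
    by_cases hqm : q.1 = maximalIdeal R
    · rw [hqm, h.residueField_eq_zero hR, Finset.sum_eq_zero]
      intro p _
      rw [localLength_quotient_of_not_le]
      · simp
      · intro hle
        have hpm : p.1.asIdeal = maximalIdeal R :=
          le_antisymm (le_maximalIdeal p.1.2.ne_top) hle
        have h₁ := p.2
        have h₂ := maximalIdeal_height_eq_ringKrullDim (R := R)
        rw [← hpm, h₁, hdim] at h₂
        exact absurd (WithBot.coe_inj.1 h₂ : (1 : ℕ∞) = 2) (by decide)
    · let q' : PrimeHeightOne R := ⟨q, Ideal.height_eq_one_of_ringKrullDim_eq_two hdim hq0 hqm⟩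
      rw [Finset.sum_eq_single_of_mem q' (hS q' hxq)]
      · have : localLength q'.1.asIdeal (R ⧸ q.1) = 1 := localLength_quotient_self q.1
        rw [this]
        simp [q']
      · intro p _ hpq
        rw [localLength_quotient_of_not_le]
        · simp
        · exact fun hle => hpq (Subtype.ext (PrimeSpectrum.ext
            (Ideal.eq_of_le_of_height_eq_one p.2 hq0 hle).symm))
  | exact N₁ N₂ N₃ f g hf hg hfg h₁ h₃ =>
    intro hN
    have hN₁ : ∀ n : N₁, x • n = 0 := fun n => hf (by rw [map_smul, hN, map_zero])
    have hN₃ : ∀ n : N₃, x • n = 0 := fun n => by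
      obtain ⟨y, rfl⟩ := hg n
      rw [← map_smul, hN, map_zero]
    rw [h N₁ N₂ N₃ f g hf hg hfg, h₁ hN₁, h₃ hN₃, ← Finset.sum_add_distrib]
    refine Finset.sum_congr rfl fun p _ => ?_
    rw [localLength_eq_add_of_exact _ f g hf hg hfg,
      ENat.toNat_add (localLength_ne_top_of_smul_eq_zero hx p N₁ hN₁)
        (localLength_ne_top_of_smul_eq_zero hx p N₃ hN₃)]
    push_cast
    ring

/-- This is `θ(R/(x)) = 0`, which holds because `x` is a nonzerodivisor, rewritten by
`eq_sum_localLength`. -/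
theorem IsAdditiveOnFinite.sum_divOf_eq_zero {x : R} (hx : x ≠ 0) :
    (divOf R x hx).sum (fun p n => n * θ (R ⧸ p.1.asIdeal)) = 0 := by
  have hann : ∀ n : R ⧸ Ideal.span {x}, x • n = 0 := fun n => by
    rw [Algebra.smul_def, Ideal.Quotient.algebraMap_eq,
      Ideal.Quotient.eq_zero_iff_mem.2 (Ideal.mem_span_singleton_self x), zero_mul]
  have hord (p : PrimeHeightOne R) :
      (localLength p.1.asIdeal (R ⧸ Ideal.span {x})).toNat = ordAt R p x := by
    rw [localLength_quotient_span_singleton, ordAt]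
  have hS : ∀ p : PrimeHeightOne R, x ∈ p.1.asIdeal → p ∈ (divOf R x hx).support := by
    intro p hp
    rw [Finsupp.mem_support_iff]
    change ((ordAt R p x : ℕ) : ℤ) ≠ 0
    -- `toNat` sends both `0` and `⊤` to `0`, so both values must be excluded.
    rw [← hord, Nat.cast_ne_zero, Ne, ENat.toNat_eq_zero, not_or]
    refine ⟨?_, localLength_ne_top_of_smul_eq_zero hx p _ hann⟩
    rw [localLength_quotient, Module.length_eq_zero_iff, Ideal.Quotient.subsingleton_iff]
    refine fun htop => (maximalIdeal.isMaximal (Localization.AtPrime p.1.asIdeal)).ne_top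
      (top_le_iff.1 (htop ▸ ?_))
    rw [← Localization.AtPrime.map_eq_maximalIdeal]
    exact Ideal.map_mono ((Ideal.span_singleton_le_iff_mem _).2 hp)
  have hθ : θ (R ⧸ Ideal.span {x}) = 0 := by
    refine h.eq_zero_of_regular_quotient (x • LinearMap.id) (Ideal.span {x}).mkQ
      (fun a b hab => mul_left_cancel₀ hx hab) (Submodule.mkQ_surjective _) fun a => ?_
    rw [Submodule.mkQ_apply, Submodule.Quotient.mk_eq_zero, Ideal.mem_span_singleton]
    exact ⟨fun ⟨b, hb⟩ => ⟨b, hb.symm⟩, fun ⟨b, hb⟩ => ⟨b, hb.symm⟩⟩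
  rw [h.eq_sum_localLength hdim hR hx _ hS _ hann] at hθ
  simp only [hord] at hθ
  exact hθ

/-- For height-one `p`, the map `[p] ↦ θ(R/p)` factors through the torsion class group, and its
target `ℤ` is torsion-free. -/
theorem IsAdditiveOnFinite.eq_zero_of_isOfFinAddOrder
    (htors : ∀ c : DivisorClassGroup R, IsOfFinAddOrder c)
    (N : Type u) [AddCommGroup N] [Module R N] [Module.Finite R N] : θ N = 0 := by
  refine h.eq_zero_of_forall_prime (fun p hp => ?_) N
  by_cases hpm : p = maximalIdeal R
  · rw [hpm, h.residueField_eq_zero hR]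
  by_cases hp0 : p = ⊥
  · rw [hp0, ← h.eq_of_equiv (Submodule.quotEquivOfEqBot (⊥ : Ideal R) rfl).symm, hR]
  let p' : PrimeHeightOne R :=
    ⟨⟨p, hp⟩, Ideal.height_eq_one_of_ringKrullDim_eq_two hdim hp0 hpm⟩
  let Φ : WeilDivisor R →+ ℤ :=
    Finsupp.liftAddHom fun q => AddMonoidHom.mulRight (θ (R ⧸ q.1.asIdeal))
  have hΦ : principalDivisors R ≤ Φ.ker := by
    refine (AddSubgroup.closure_le _).2 ?_
    rintro _ ⟨x, hx, rfl⟩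
    exact h.sum_divOf_eq_zero hdim hR hx
  obtain ⟨n, hn, hn0⟩ :=
    isOfFinAddOrder_iff_nsmul_eq_zero.1 (htors (QuotientAddGroup.mk (Finsupp.single p' 1)))
  rw [← QuotientAddGroup.mk_nsmul, QuotientAddGroup.eq_zero_iff] at hn0
  have := hΦ hn0
  rw [AddMonoidHom.mem_ker, map_nsmul, Finsupp.liftAddHom_apply_single,
    smul_eq_zero] at this
  exact (one_mul _).symm.trans (this.resolve_left hn.ne')

end Surface

end TorsionClassGroup

/-! ### Additivity of the alternating sum, and rigidity. -/

section Rigidity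

open IsLocalRing

theorem sum_range_neg_one_pow_mul_add (c : ℕ → ℤ) (n q : ℕ) :
    ∑ i ∈ Finset.range q, (-1) ^ i * (c (n + i + 1) + c (n + i)) = c n - (-1) ^ q * c (n + q) := by
  induction q with
  | zero => simp
  | succ q ih => rw [Finset.sum_range_succ, ih, ← add_assoc]; ring

/-- If a periodic sequence is of the form `c (i + 1) + c i` with `c` bounded, then its alternating
sum over an even period vanishes. -/
theorem alternating_sum_eq_zero_of_bounded {q : ℕ} (hq : Even q) {e c : ℕ → ℤ} {B : ℕ}
    (he : ∀ i, e (i + q) = e i) (hec : ∀ i, e i = c (i + 1) + c i) (hc : ∀ i, 0 ≤ c i)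
    (hB : ∀ k, c (k * q) ≤ B) : ∑ i ∈ Finset.range q, (-1) ^ i * e i = 0 := by
  set D := ∑ i ∈ Finset.range q, (-1) ^ i * e i with hD
  have hstep (n : ℕ) : ∑ i ∈ Finset.range q, (-1) ^ i * e (n + i) = c n - c (n + q) := by
    simp only [hec, sum_range_neg_one_pow_mul_add, hq.neg_one_pow, one_mul]
  have hper (k i : ℕ) : e (k * q + i) = e i := by
    induction k with
    | zero => simp
    | succ k ih => rw [← ih, ← he (k * q + i)]; congr 1; ring
  have hk (k : ℕ) : c (k * q) = c 0 - k * D := by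
    induction k with
    | zero => simp
    | succ k ih =>
      have h := hstep (k * q)
      simp only [hper] at h
      rw [add_mul, one_mul]
      push_cast
      linarith
  have h₀ := hc 0
  have h₁ := hB 0
  -- A nonzero `D` would move `c` by at least `B + 1` over `B + 1` periods, out of the interval `[0,
  -- B]`.
  have h₂ := hc ((B + 1) * q)
  have h₃ := hB (B + 1)
  rw [hk] at h₂ h₃
  rw [zero_mul] at h₁
  push_cast at h₂ h₃
  have hB0 : (0 : ℤ) ≤ B := Int.natCast_nonneg B
  rcases lt_trichotomy D 0 with hlt | h0 | hgt
  · nlinarith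
  · exact h0
  · nlinarith

variable {R : Type u} [CommRing R]

/-- The alternating sum of the lengths of `Tor_i(M, N)` for `i = r + 1, …, r + q`. -/
noncomputable def torTheta (R : Type u) [CommRing R] (M : Type u) [AddCommGroup M] [Module R M]
    (r q : ℕ) (N : Type u) [AddCommGroup N] [Module R N] : ℤ :=
  ∑ i ∈ Finset.range q, (-1) ^ i * ((torLength R M N (r + i + 1)).toNat : ℤ)

theorem torLength_ne_top [IsNoetherianRing R] [IsLocalRing R] {M : Type u} [AddCommGroup M]
    [Module R M] (F : MinimalFreeResolution R M)
    (hM : ∀ p : Ideal R, p.IsPrime → p ≠ maximalIdeal R → ∃ s ∉ p, FactorsThroughFree M s)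
    (N : Type u) [AddCommGroup N] [Module R N] [Module.Finite R N] (i : ℕ) :
    torLength R M N (i + 1) ≠ ⊤ := by
  have := tor_finite F N (i + 1)
  refine Module.length_ne_top_of_forall_prime_exists_smul_eq_zero fun p hp hpm => ?_
  obtain ⟨s, hs, n, g, f, h⟩ := hM p hp hpm
  exact ⟨s, hs, smul_tor_eq_zero_of_factors N g f h i⟩

theorem torTheta_isAdditiveOnFinite {M : Type u} [AddCommGroup M] [Module R M] (r : ℕ) {q : ℕ}
    (hq : Even q)
    (hfin : ∀ (N : Type u) [AddCommGroup N] [Module R N] [Module.Finite R N] (i : ℕ),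
      torLength R M N (i + 1) ≠ ⊤)
    (hper : ∀ (N : Type u) [AddCommGroup N] [Module R N] (i : ℕ),
      torLength R M N (i + 1 + q) = torLength R M N (i + 1)) :
    IsAdditiveOnFinite R (torTheta R M r q) := by
  intro N₁ N₂ N₃ _ _ _ _ _ _ _ _ _ f g hf hg hfg
  obtain ⟨c, hc, hsum⟩ := exists_torLength_add_eq_of_exact M f g hf hg hfg
  have hcfin (i : ℕ) : c (i + 1) ≠ ⊤ := ne_top_of_le_ne_top (hfin N₃ i) (hc i)
  let t (N : Type u) [AddCommGroup N] [Module R N] (i : ℕ) : ℤ :=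
    ((torLength R M N (r + i + 1)).toNat : ℤ)
  have htper (N : Type u) [AddCommGroup N] [Module R N] (i : ℕ) : t N (i + q) = t N i := by
    simp only [t]
    rw [← hper N (r + i)]
    congr 3
    ring
  have htper' (k : ℕ) : t N₃ (k * q) = t N₃ 0 := by
    induction k with
    | zero => simp
    | succ k ih => rw [add_mul, one_mul, htper, ih]
  -- No periodicity of the connecting maps is required: their images are bounded by the Tors of
  -- `N₃`, whose lengths in degrees `r + k * q + 1` are all equal.
  have key := alternating_sum_eq_zero_of_bounded hq
    (e := fun i => t N₁ i + t N₃ i - t N₂ i) (c := fun i => ((c (r + i + 1)).toNat : ℤ))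
    (B := (torLength R M N₃ (r + 0 + 1)).toNat) (fun i => by simp only [htper]) (fun i => ?_)
    (fun i => Int.natCast_nonneg _) (fun k => ?_)
  · simp only [mul_sub, mul_add, Finset.sum_sub_distrib, Finset.sum_add_distrib] at key
    simp only [torTheta]
    linarith
  · have hc₂ : c (r + i + 2) ≠ ⊤ := hcfin (r + i + 1)
    have hc₃ : c (r + i + 2) + c (r + i + 1) ≠ ⊤ := WithTop.add_ne_top.2 ⟨hc₂, hcfin _⟩
    have h := congrArg ENat.toNat (hsum (r + i))
    rw [ENat.toNat_add (hfin N₁ _) (hfin N₃ _),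
      ENat.toNat_add hc₃ (hfin N₂ _),
      ENat.toNat_add hc₂ (hcfin _)] at h
    simp only [t]
    have h' : ((torLength R M N₁ (r + i + 1)).toNat : ℤ) + (torLength R M N₃ (r + i + 1)).toNat =
      (c (r + i + 2)).toNat + (c (r + i + 1)).toNat + (torLength R M N₂ (r + i + 1)).toNat := by
      exact_mod_cast h
    rw [h', ← add_assoc r i 1]
    ring
  · refine le_trans ?_ (htper' k).le
    exact Int.ofNat_le.2 <| ENat.toNat_le_toNat (hc (r + k * q)) (hfin N₃ _)

/-- A `q`-periodic module (`q` even) which is locally free on the punctured spectrum is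
`(q - 1)`-Tor-rigid, if every additive function on finitely generated modules which vanishes on
`R` is zero. -/
theorem isNTorRigid_of_isoSyzygy [IsNoetherianRing R] [IsLocalRing R] {M : Type u}
    [AddCommGroup M] [Module R M]
    (hadd : ∀ θ : (N : Type u) → [AddCommGroup N] → [Module R N] → ℤ, IsAdditiveOnFinite R θ →
      θ R = 0 → ∀ (N : Type u) [AddCommGroup N] [Module R N] [Module.Finite R N], θ N = 0)
    (hM : ∀ p : Ideal R, p.IsPrime → p ≠ maximalIdeal R → ∃ s ∉ p, FactorsThroughFree M s)
    {q : ℕ} (hq : Even (q + 1)) (h : IsoSyzygy R M (q + 1)) : IsNTorRigid R q M := by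
  have hper (N : Type u) [AddCommGroup N] [Module R N] (i : ℕ) :
      torLength R M N (i + 1 + (q + 1)) = torLength R M N (i + 1) :=
    torLength_add_of_isoSyzygy M N q h i
  obtain ⟨F, -⟩ := h
  have hfin (N : Type u) [AddCommGroup N] [Module R N] [Module.Finite R N] (i : ℕ) :=
    torLength_ne_top F hM N i
  intro N _ _ _ r hr hvan
  obtain ⟨r, rfl⟩ := Nat.exists_eq_add_of_le' hr
  simp only [torVanishes_iff_torLength_eq_zero] at hvan ⊢
  have hθ := hadd _ (torTheta_isAdditiveOnFinite r hq hfin hper)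
    (Finset.sum_eq_zero fun i _ => by rw [torLength_eq_zero_of_flat]; simp) N
  -- The period is `q + 1` and `r` has been lowered by one. The hypothesis kills degrees `r + 1` to
  -- `r + q`, so only degree `r + q + 1` is left in `θ(N)`.
  rw [torTheta, Finset.sum_range_succ, Finset.sum_eq_zero, zero_add, mul_eq_zero] at hθ
  · have hlast : torLength R M N (r + q + 1) = 0 := by
      have h0 := hθ.resolve_left (pow_ne_zero _ (by norm_num))
      rw [Nat.cast_eq_zero, ENat.toNat_eq_zero] at h0
      exact h0.resolve_right (hfin N _)
    intro j
    induction j using Nat.strong_induction_on with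
    | _ j ih =>
      intro hj
      rcases lt_trichotomy j (r + q + 1) with hlt | rfl | hgt
      · exact hvan j hj (by omega)
      · exact hlast
      -- Going down one period stays in degrees at least `r + 1`.
      · obtain ⟨k, rfl⟩ := Nat.exists_eq_add_of_lt hgt
        rw [show r + q + 1 + k + 1 = r + k + 1 + (q + 1) by ring, hper]
        exact ih (r + k + 1) (by omega) (by omega)
  · intro i hi
    rw [hvan _ (by omega) (by have := Finset.mem_range.1 hi; omega)]
    simp

theorem IsoSyzygy.exists_factorsThroughFree [IsDomain R] [IsNoetherianRing R] [IsLocalRing R]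
    {M : Type u} [AddCommGroup M] [Module R M] {q : ℕ} (h : IsoSyzygy R M (q + 1)) (p : Ideal R)
    [p.IsPrime] [IsPrincipalIdealRing (Localization.AtPrime p)] :
    ∃ s ∉ p, FactorsThroughFree M s := by
  obtain ⟨F, ⟨e⟩⟩ := h
  obtain ⟨s, hs, hs'⟩ := exists_factorsThroughFree_of_isPrincipalIdealRing
    (LinearMap.range (F.d q)) p
  exact ⟨s, hs, hs'.of_equiv e.toLinearEquiv⟩

end Rigidity

theorem mainTheorem8 (R : Type u) [CommRing R] [IsNoetherianRing R] [IsLocalRing R]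
    (hR : IsArtinianRing R ∨ (IsDomain R ∧ ringKrullDim R = 1) ∨
      IsNormalSurfaceWithTorsionClassGroup R)
    (M : Type u) [AddCommGroup M] [Module R M] [Module.Finite R M] :
    (∀ q : ℕ, Even q → 2 ≤ q → IsoSyzygy R M q → IsNTorRigid R (q - 1) M) ∧
      (IsoSyzygy R M 2 → IsTorRigid R M) := by
  -- Indexing by the period minus one removes the truncated subtraction.
  have main : ∀ q : ℕ, Even (q + 1) → IsoSyzygy R M (q + 1) → IsNTorRigid R q M := by
    intro q hq h
    rcases hR with hA | ⟨hD, hdim⟩ | ⟨hD, hN, hdim, htors⟩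
    · exact isNTorRigid_of_isoSyzygy (fun θ hθ h0 N => hθ.eq_zero_of_isArtinianRing h0 N)
        (fun p hp hpm => absurd (IsLocalRing.eq_maximalIdeal
          (IsArtinianRing.isMaximal_of_isPrime p)) hpm) hq h
    · refine isNTorRigid_of_isoSyzygy
        (fun θ hθ h0 N => hθ.eq_zero_of_ringKrullDim_eq_one hdim h0 N) (fun p hp hpm => ?_) hq h
      have := isPrincipalIdealRing_localization_bot (eq_bot_of_ringKrullDim_eq_one hdim hpm)
      exact h.exists_factorsThroughFree p
    · refine isNTorRigid_of_isoSyzygy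
        (fun θ hθ h0 N => hθ.eq_zero_of_isOfFinAddOrder hdim h0 htors N)
        (fun p hp hpm => ?_) hq h
      have : IsPrincipalIdealRing (Localization.AtPrime p) := by
        by_cases hp0 : p = ⊥
        · exact isPrincipalIdealRing_localization_bot hp0
        · exact isPrincipalIdealRing_localization_of_height_eq_one
            (Ideal.height_eq_one_of_ringKrullDim_eq_two hdim hp0 hpm)
      exact h.exists_factorsThroughFree p
  refine ⟨fun q hq h2 h => ?_, main 1 (by decide)⟩
  obtain ⟨q, rfl⟩ := Nat.exists_eq_add_of_le' (by omega : 1 ≤ q)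
  exact main q hq h
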